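/- Let $\delta\ge 0$ and $H,\rho,\sigma,r$ be real numbers such that $1<\dfrac{\rho}{\delta+H}\le e$, and let $\lambda>0$ be the positive root of the equation $$-z-\delta-He^{-\sigma z}+\rho e^{-rz}=0 .$$ Suppose that 1. $\sigma<r$; 2. $0<\sigma\le\sigma_0$, where $\sigma_0$ satisfies $H\sigma_0e^{1+\sigma_0\delta}=1$ (so $H>0$, hence also $\rho>0$, and the root $\lambda$ is unique); 3. $He^{-(\lambda+\epsilon)\sigma}-\rho e^{-(\lambda+\epsilon)r}\ge 0$ for some $0<\epsilon<\lambda$. Put $\kappa=\ln\!\left(\dfrac{\rho}{\delta+H}\right)$. Then $\kappa>0$, and the delayed Nicholson equation with linear harvesting $$x'(t)=\rho\,x(t-r)e^{-x(t-r)}-\delta x(t)-Hx(t-\sigma),\qquad t\in\mathbb{R},$$ has a monotone heteroclinic solution connecting its equilibria $0$ and $\kappa$; that is, there is a non-decreasing function $x\in C^1(\mathbb{R},\mathbb{R})$ that satisfies the equation for all $t\in\mathbb{R}$, with $\lim_{t\to-\infty}x(t)=0$ and $\lim_{t\to+\infty}x(t)=\kappa$. -/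

import Mathlib

/-- The right-hand side at time `t` of the delayed Nicholson equation with linear harvesting,
`x'(t) = ρ x(t - r) e^{-x(t - r)} - δ x(t) - H x(t - σ)`. -/
noncomputable def nicholsonRHS (δ H ρ σ r : ℝ) (x : ℝ → ℝ) (t : ℝ) : ℝ :=
  ρ * x (t - r) * Real.exp (-x (t - r)) - δ * x t - H * x (t - σ)

/-- The constant function with value `c` is an equilibrium solution of the functional
differential equation `x'(t) = F x t`. -/
def IsEquilibrium (F : (ℝ → ℝ) → ℝ → ℝ) (c : ℝ) : Prop :=
  ∀ t : ℝ, F (fun _ => c) t = 0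

/-- `x` is a monotone heteroclinic solution of `x'(t) = F x t` on the whole real line, going
from the equilibrium `a` at `-∞` to the equilibrium `b ≥ a` at `+∞`
(so that monotone means non-decreasing). -/
structure IsMonotoneHeteroclinic (F : (ℝ → ℝ) → ℝ → ℝ) (a b : ℝ) (x : ℝ → ℝ) : Prop where
  equilibrium_left : IsEquilibrium F a
  equilibrium_right : IsEquilibrium F b
  contDiff : ContDiff ℝ 1 x
  monotone : Monotone x
  solution : ∀ t : ℝ, HasDerivAt x (F x t) t
  tendsto_atBot : Filter.Tendsto x Filter.atBot (nhds a)
  tendsto_atTop : Filter.Tendsto x Filter.atTop (nhds b)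

/-- The characteristic function at the zero equilibrium,
`χ₀(z) = -z - δ - H e^{-σ z} + ρ e^{-r z}`. -/
noncomputable def nicholsonChar (δ H ρ σ r z : ℝ) : ℝ :=
  -z - δ - H * Real.exp (-(σ * z)) + ρ * Real.exp (-(r * z))

/-! The term `-H x(t - σ)` destroys monotonicity in `x`, so the unknown becomes `v = x' + μ x`, that
is `x = expAvg μ v`, and the equation becomes a fixed point problem for `nicholsonOp`. In terms of
`v`, the combination `(μ - δ) x(t) - H x(t - σ)` is order-preserving as soon as `H e^{μ σ} ≤ μ - δ`
(`mul_expAvg_sub_delay_nonneg`), and hypothesis 2 supplies such a `μ`. As `κ ≤ 1`, the map `u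
e^{-u}` is increasing on `[0, κ]`, so the whole operator is order-preserving.

It then suffices to find ordered upper and lower solutions: `min(e^{λ t}, μ κ)` and `max(0, e^{λ t}
- M e^{(λ + ε) t})`, the latter by hypothesis 3 (`exists_lowerSolution`). Knaster–Tarski gives a
non-decreasing fixed point without any compactness. The upper solution forces the limit `0` at `-∞`;
the lower one makes `x` nonzero, so its limit at `+∞` is a positive equilibrium, which must be `κ`.
-/

open MeasureTheory Set Filter Topology

/-! ### Exponential averaging and its order properties -/

/-- The convolution `∫₀^∞ e^{-μ s} v(t - s) ds`, written as `e^{-μ t} ∫_{-∞}^t e^{μ s} v(s) ds`.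
It is the solution operator of `x' + μ x = v` on functions that do not grow too fast at `-∞`. -/
noncomputable def expAvg (μ : ℝ) (v : ℝ → ℝ) (t : ℝ) : ℝ :=
  Real.exp (-(μ * t)) * ∫ s in Iic t, Real.exp (μ * s) * v s

/-- The integrals defining `expAvg μ v` converge. -/
def ExpIntegrable (μ : ℝ) (v : ℝ → ℝ) : Prop :=
  ∀ t, IntegrableOn (fun s => Real.exp (μ * s) * v s) (Iic t)

theorem expIntegrable_exp {μ z : ℝ} (h : 0 < z + μ) :
    ExpIntegrable μ (fun s => Real.exp (z * s)) := by
  intro t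
  have := integrableOn_exp_mul_Iic h t
  refine this.congr_fun (fun s _ => ?_) measurableSet_Iic
  simp only [← Real.exp_add]
  congr 1; ring

theorem expAvg_exp {μ z : ℝ} (h : 0 < z + μ) (t : ℝ) :
    expAvg μ (fun s => Real.exp (z * s)) t = Real.exp (z * t) / (z + μ) := by
  have h1 : (∫ s in Iic t, Real.exp (μ * s) * Real.exp (z * s))
      = Real.exp ((z + μ) * t) / (z + μ) := by
    rw [← integral_exp_mul_Iic h]
    congr 1; ext s
    rw [← Real.exp_add]; congr 1; ring
  rw [expAvg, h1, ← mul_div_assoc, ← Real.exp_add]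
  congr 2; ring

theorem expAvg_const {μ : ℝ} (h : 0 < μ) (b t : ℝ) : expAvg μ (fun _ => b) t = b / μ := by
  have h1 := expAvg_exp (μ := μ) (z := 0) (by simpa using h) t
  simp only [expAvg, zero_mul, Real.exp_zero, mul_one, zero_add] at h1
  rw [expAvg, integral_mul_const, ← mul_assoc, h1]; ring

theorem expIntegrable_const {μ : ℝ} (h : 0 < μ) (b : ℝ) : ExpIntegrable μ (fun _ => b) := by
  intro t
  exact (integrableOn_exp_mul_Iic h t).mul_const b

theorem ExpIntegrable.sub {μ : ℝ} {v w : ℝ → ℝ} (hv : ExpIntegrable μ v)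
    (hw : ExpIntegrable μ w) : ExpIntegrable μ (fun s => v s - w s) := by
  intro t
  simp only [mul_sub]
  exact (hv t).sub (hw t)

theorem ExpIntegrable.const_mul {μ : ℝ} {v : ℝ → ℝ} (hv : ExpIntegrable μ v) (c : ℝ) :
    ExpIntegrable μ (fun s => c * v s) := by
  intro t
  simp only [mul_left_comm _ c]
  exact Integrable.const_mul (hv t) c

theorem expAvg_sub {μ : ℝ} {v w : ℝ → ℝ} (hv : ExpIntegrable μ v)
    (hw : ExpIntegrable μ w) (t : ℝ) :
    expAvg μ (fun s => v s - w s) t = expAvg μ v t - expAvg μ w t := by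
  simp only [expAvg, mul_sub]
  rw [integral_sub (hv t) (hw t)]; ring

theorem expAvg_const_mul {μ : ℝ} (v : ℝ → ℝ) (c t : ℝ) :
    expAvg μ (fun s => c * v s) t = c * expAvg μ v t := by
  simp only [expAvg, mul_left_comm _ c]
  rw [integral_const_mul]; ring

theorem expIntegrable_of_monotone {μ : ℝ} {v w : ℝ → ℝ} (hv : Monotone v) (h0 : ∀ s, 0 ≤ v s)
    (hvw : ∀ s, v s ≤ w s) (hw : ExpIntegrable μ w) : ExpIntegrable μ v := by
  intro t
  refine Integrable.mono' (hw t) ?_ (ae_of_all _ fun s => ?_)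
  · exact (Measurable.mul (by fun_prop) hv.measurable).aestronglyMeasurable
  · rw [Real.norm_of_nonneg (mul_nonneg (Real.exp_pos _).le (h0 s))]
    exact mul_le_mul_of_nonneg_left (hvw s) (Real.exp_pos _).le

theorem expAvg_mono {μ : ℝ} {v w : ℝ → ℝ} (hv : ExpIntegrable μ v) (hw : ExpIntegrable μ w)
    (hvw : ∀ s, v s ≤ w s) (t : ℝ) : expAvg μ v t ≤ expAvg μ w t :=
  mul_le_mul_of_nonneg_left
    (setIntegral_mono (hv t) (hw t) fun s =>
      mul_le_mul_of_nonneg_left (hvw s) (Real.exp_pos _).le) (Real.exp_pos _).le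

theorem expAvg_nonneg {μ : ℝ} {v : ℝ → ℝ} (h0 : ∀ s, 0 ≤ v s) (t : ℝ) : 0 ≤ expAvg μ v t :=
  mul_nonneg (Real.exp_pos _).le
    (integral_nonneg fun s => mul_nonneg (Real.exp_pos _).le (h0 s))

theorem expAvg_comp_add_right (μ : ℝ) (v : ℝ → ℝ) (h t : ℝ) :
    expAvg μ (fun s => v (s + h)) t = expAvg μ v (t + h) := by
  have h1 := (measurePreserving_add_right volume h).setIntegral_preimage_emb
    (measurableEmbedding_addRight h) (fun s => Real.exp (μ * s) * v s) (Iic (t + h))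
  have h2 : (fun s => s + h) ⁻¹' Iic (t + h) = Iic t := by ext s; simp
  rw [h2] at h1
  have h3 : ∀ s, Real.exp (μ * s) * v (s + h)
      = Real.exp (-(μ * h)) * (Real.exp (μ * (s + h)) * v (s + h)) := by
    intro s
    rw [← mul_assoc, ← Real.exp_add]; congr 2; ring
  simp only [expAvg, h3]
  rw [integral_const_mul, h1, ← mul_assoc, ← Real.exp_add]
  congr 2; ring

theorem ExpIntegrable.comp_add_right {μ : ℝ} {v : ℝ → ℝ} (hv : ExpIntegrable μ v) (h : ℝ) :
    ExpIntegrable μ (fun s => v (s + h)) := by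
  intro t
  have h1 := (measurePreserving_add_right volume h).integrableOn_comp_preimage
    (measurableEmbedding_addRight h) (f := fun s => Real.exp (μ * s) * v s) (s := Iic (t + h))
  have h2 : (fun s => s + h) ⁻¹' Iic (t + h) = Iic t := by ext s; simp
  rw [h2] at h1
  refine IntegrableOn.congr_fun (Integrable.const_mul (h1.2 (hv (t + h))) (Real.exp (-(μ * h))))
    (fun s _ => ?_) measurableSet_Iic
  simp only [Function.comp]
  rw [← mul_assoc, ← Real.exp_add]; congr 2; ring

theorem expAvg_eq_intervalIntegral {μ : ℝ} {v : ℝ → ℝ} (hv : ExpIntegrable μ v) (t : ℝ) :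
    expAvg μ v t = Real.exp (-(μ * t)) *
      ((∫ s in Iic 0, Real.exp (μ * s) * v s) + ∫ s in (0 : ℝ)..t, Real.exp (μ * s) * v s) := by
  rw [← intervalIntegral.integral_Iic_sub_Iic (hv 0) (hv t), expAvg]; ring

theorem ExpIntegrable.continuous_expAvg {μ : ℝ} {v : ℝ → ℝ} (hv : ExpIntegrable μ v) :
    Continuous (expAvg μ v) := by
  have h : ∀ a b, IntervalIntegrable (fun s => Real.exp (μ * s) * v s) volume a b := fun a b =>
    ⟨(hv b).mono_set Ioc_subset_Iic_self, (hv a).mono_set Ioc_subset_Iic_self⟩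
  rw [funext (expAvg_eq_intervalIntegral hv)]
  have := intervalIntegral.continuous_primitive h 0
  fun_prop

theorem ExpIntegrable.hasDerivAt_expAvg {μ : ℝ} {v : ℝ → ℝ} (hv : ExpIntegrable μ v)
    (hc : Continuous v) (t : ℝ) : HasDerivAt (expAvg μ v) (v t - μ * expAvg μ v t) t := by
  have hc' : Continuous fun s => Real.exp (μ * s) * v s := by fun_prop
  have h1 : HasDerivAt (fun t => ∫ s in (0 : ℝ)..t, Real.exp (μ * s) * v s)
      (Real.exp (μ * t) * v t) t := hc'.integral_hasStrictDerivAt 0 t |>.hasDerivAt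
  have h2 : HasDerivAt (fun t => Real.exp (-(μ * t))) (Real.exp (-(μ * t)) * (-(μ * 1))) t :=
    (((hasDerivAt_id t).const_mul μ).neg).exp
  have h3 := h2.mul (h1.const_add (∫ s in Iic 0, Real.exp (μ * s) * v s))
  rw [expAvg_eq_intervalIntegral hv t, funext (expAvg_eq_intervalIntegral hv)]
  refine h3.congr_deriv ?_
  have h4 : Real.exp (-(μ * t)) * Real.exp (μ * t) = 1 := by rw [← Real.exp_add]; simp
  linear_combination v t * h4

/-- Positivity of `v ↦ c x(t) - H x(t - σ)`, with `x = expAvg μ v`, when `H e^{μ σ} ≤ c`. -/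
theorem mul_expAvg_sub_delay_nonneg {μ c H σ : ℝ} {v : ℝ → ℝ} (hH : 0 ≤ H) (hσ : 0 ≤ σ)
    (hc : H * Real.exp (μ * σ) ≤ c) (hv : ExpIntegrable μ v) (h0 : ∀ s, 0 ≤ v s) (t : ℝ) :
    0 ≤ c * expAvg μ v t - H * expAvg μ v (t - σ) := by
  have hpos : ∀ s, 0 ≤ Real.exp (μ * s) * v s := fun s => mul_nonneg (Real.exp_pos _).le (h0 s)
  have h1 : (∫ s in Iic (t - σ), Real.exp (μ * s) * v s) ≤ ∫ s in Iic t, Real.exp (μ * s) * v s :=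
    setIntegral_mono_set (hv t) (ae_of_all _ hpos)
      (Eventually.of_forall (Iic_subset_Iic.2 (by linarith)))
  have h2 : 0 ≤ ∫ s in Iic (t - σ), Real.exp (μ * s) * v s := integral_nonneg hpos
  have h3 : Real.exp (-(μ * (t - σ))) = Real.exp (-(μ * t)) * Real.exp (μ * σ) := by
    rw [← Real.exp_add]; congr 1; ring
  -- The delay multiplies the prefactor `e^{-μ t}` by `e^{μ σ}` but shrinks the domain of
  -- integration, so `hc` is enough.
  have h4 : H * Real.exp (μ * σ) * (∫ s in Iic (t - σ), Real.exp (μ * s) * v s)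
      ≤ c * ∫ s in Iic t, Real.exp (μ * s) * v s :=
    mul_le_mul hc h1 h2 (le_trans (mul_nonneg hH (Real.exp_pos _).le) hc)
  have h5 := mul_le_mul_of_nonneg_left h4 (Real.exp_pos (-(μ * t))).le
  rw [expAvg, expAvg, h3]
  linarith

theorem mul_expAvg_sub_delay_mono {μ c H σ : ℝ} {v w : ℝ → ℝ} (hH : 0 ≤ H) (hσ : 0 ≤ σ)
    (hc : H * Real.exp (μ * σ) ≤ c) (hv : ExpIntegrable μ v) (hw : ExpIntegrable μ w)
    (hvw : ∀ s, v s ≤ w s) (t : ℝ) :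
    c * expAvg μ v t - H * expAvg μ v (t - σ) ≤ c * expAvg μ w t - H * expAvg μ w (t - σ) := by
  have h := mul_expAvg_sub_delay_nonneg hH hσ hc (hw.sub hv) (fun s => sub_nonneg.2 (hvw s)) t
  rw [expAvg_sub hw hv, expAvg_sub hw hv] at h
  linarith

theorem monotone_expAvg {μ : ℝ} {v : ℝ → ℝ} (hv : ExpIntegrable μ v) (hm : Monotone v) :
    Monotone (expAvg μ v) := by
  intro a b hab
  have h := expAvg_mono hv (hv.comp_add_right (b - a)) (fun s => hm (by linarith)) a
  rwa [expAvg_comp_add_right, add_sub_cancel] at h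

/-- From `e^{-(w - u)} ≥ 1 - (w - u)`, the claim reduces to `(w - u)(1 - w) ≥ 0`. -/
theorem mul_exp_neg_le_mul_exp_neg {u w : ℝ} (h0 : 0 ≤ u) (huw : u ≤ w) (hw : w ≤ 1) :
    u * Real.exp (-u) ≤ w * Real.exp (-w) := by
  have h1 : Real.exp (-w) = Real.exp (-u) * Real.exp (-(w - u)) := by
    rw [← Real.exp_add]; congr 1; ring
  have h2 := Real.one_sub_le_exp_neg (w - u)
  have h3 : u ≤ w * Real.exp (-(w - u)) := by
    nlinarith [mul_le_mul_of_nonneg_left h2 (h0.trans huw)]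
  rw [h1]
  nlinarith [mul_le_mul_of_nonneg_left h3 (Real.exp_pos (-u)).le]

/-! ### Abstract fixed point and limit arguments -/

/-- A Knaster–Tarski fixed point theorem for an operator on the non-decreasing real functions
between a lower solution and an upper solution. -/
theorem exists_monotone_fixedPoint {F : (ℝ → ℝ) → ℝ → ℝ} {L U : ℝ → ℝ} (hU : Monotone U)
    (hLU : ∀ t, L t ≤ U t)
    (hF : ∀ v w, Monotone v → Monotone w → (∀ t, L t ≤ v t) → (∀ t, v t ≤ w t) →
      (∀ t, w t ≤ U t) → ∀ t, F v t ≤ F w t)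
    (hFm : ∀ v, Monotone v → (∀ t, L t ≤ v t) → (∀ t, v t ≤ U t) → Monotone (F v))
    (hFU : ∀ t, F U t ≤ U t)
    (hFL : ∀ v, Monotone v → (∀ t, L t ≤ v t) → (∀ t, v t ≤ U t) → ∀ t, L t ≤ F v t) :
    ∃ v, Monotone v ∧ (∀ t, L t ≤ v t) ∧ (∀ t, v t ≤ U t) ∧ ∀ t, F v t = v t := by
  let S : Set (ℝ → ℝ) :=
    {w | Monotone w ∧ (∀ t, L t ≤ w t) ∧ (∀ t, w t ≤ U t) ∧ ∀ t, F w t ≤ w t}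
  have hUS : U ∈ S := ⟨hU, hLU, fun _ => le_rfl, hFU⟩
  have : Nonempty S := ⟨⟨U, hUS⟩⟩
  let v : ℝ → ℝ := fun t => ⨅ w : S, w.1 t
  have hbdd : ∀ t, BddBelow (range fun w : S => w.1 t) := fun t =>
    ⟨L t, by rintro _ ⟨w, rfl⟩; exact w.2.2.1 t⟩
  have hle : ∀ w ∈ S, ∀ t, v t ≤ w t := fun w hw t => ciInf_le (hbdd t) ⟨w, hw⟩
  have hvm : Monotone v := fun a b hab => ciInf_mono (hbdd a) fun w => w.2.1 hab
  have hLv : ∀ t, L t ≤ v t := fun t => le_ciInf fun w => w.2.2.1 t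
  have hvU := hle U hUS
  have hFv : ∀ t, F v t ≤ v t := fun t => le_ciInf fun w =>
    (hF v w.1 hvm w.2.1 hLv (hle w.1 w.2) w.2.2.2.1 t).trans (w.2.2.2.2 t)
  -- `F v` is again an admissible upper solution, so the infimum `v` of all of them lies below it.
  have hFvS : F v ∈ S := by
    have hLF := hFL v hvm hLv hvU
    exact ⟨hFm v hvm hLv hvU, hLF, fun t => (hFv t).trans (hvU t),
      hF _ _ (hFm v hvm hLv hvU) hvm hLF hFv hvU⟩
  exact ⟨v, hvm, hLv, hvU, fun t => le_antisymm (hFv t) (hle _ hFvS t)⟩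

/-- By the mean value theorem on `[t, t + 1]`, the derivative takes values `x (t + 1) - x t → 0` at
points tending to infinity. -/
theorem eq_zero_of_tendsto_of_tendsto_deriv {x x' : ℝ → ℝ} {c d : ℝ}
    (hx : ∀ t, HasDerivAt x (x' t) t) (hc : Tendsto x atTop (𝓝 c)) (hd : Tendsto x' atTop (𝓝 d)) :
    d = 0 := by
  have h : ∀ t : ℝ, ∃ ξ, t < ξ ∧ x' ξ = x (t + 1) - x t := by
    intro t
    obtain ⟨ξ, hξ, h⟩ := exists_hasDerivAt_eq_slope x x' (lt_add_one t)
      (fun s _ => (hx s).continuousAt.continuousWithinAt) (fun s _ => hx s)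
    exact ⟨ξ, hξ.1, by rw [h]; simp⟩
  choose ξ hξ h using h
  have h1 : Tendsto ξ atTop atTop := tendsto_atTop_mono (fun t => (hξ t).le) tendsto_id
  have h2 : Tendsto (fun t => x (t + 1) - x t) atTop (𝓝 (c - c)) :=
    (hc.comp (tendsto_atTop_add_const_right _ 1 tendsto_id)).sub hc
  rw [sub_self] at h2
  exact tendsto_nhds_unique ((hd.comp h1).congr h) h2

/-! ### The fixed point operator and its linearization -/

/-- The linearization at `0` of `nicholsonOp`. -/
noncomputable def nicholsonLinOp (δ H ρ σ r μ : ℝ) (v : ℝ → ℝ) (t : ℝ) : ℝ :=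
  ρ * expAvg μ v (t - r) + ((μ - δ) * expAvg μ v t - H * expAvg μ v (t - σ))

/-- The operator whose fixed points `v` give the solutions `x = expAvg μ v` of the delayed
Nicholson equation. -/
noncomputable def nicholsonOp (δ H ρ σ r μ : ℝ) (v : ℝ → ℝ) (t : ℝ) : ℝ :=
  ρ * (expAvg μ v (t - r) * Real.exp (-expAvg μ v (t - r))) +
    ((μ - δ) * expAvg μ v t - H * expAvg μ v (t - σ))

section Operator

variable {δ H ρ σ r μ : ℝ}

/-- Exponentials are eigenfunctions; the eigenvalue is `1` at a root of the characteristic function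
and less than `1` where that function is negative. -/
theorem nicholsonLinOp_exp {z : ℝ} (hz : 0 < z + μ) (t : ℝ) :
    nicholsonLinOp δ H ρ σ r μ (fun s => Real.exp (z * s)) t
      = Real.exp (z * t) * (1 + nicholsonChar δ H ρ σ r z / (z + μ)) := by
  have h : ∀ a, Real.exp (z * (t - a)) = Real.exp (z * t) * Real.exp (-(a * z)) := fun a => by
    rw [← Real.exp_add]; congr 1; ring
  simp only [nicholsonLinOp, expAvg_exp hz, h, nicholsonChar]
  field_simp
  ring

theorem nicholsonLinOp_sub_mul {v w : ℝ → ℝ} (hv : ExpIntegrable μ v) (hw : ExpIntegrable μ w)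
    (M t : ℝ) : nicholsonLinOp δ H ρ σ r μ (fun s => v s - M * w s) t
      = nicholsonLinOp δ H ρ σ r μ v t - M * nicholsonLinOp δ H ρ σ r μ w t := by
  simp only [nicholsonLinOp, expAvg_sub hv (hw.const_mul M), expAvg_const_mul]
  ring

theorem nicholsonLinOp_mono (hH : 0 ≤ H) (hρ : 0 ≤ ρ) (hσ : 0 ≤ σ)
    (hμ : H * Real.exp (μ * σ) ≤ μ - δ) {v w : ℝ → ℝ} (hv : ExpIntegrable μ v)
    (hw : ExpIntegrable μ w) (hvw : ∀ s, v s ≤ w s) (t : ℝ) :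
    nicholsonLinOp δ H ρ σ r μ v t ≤ nicholsonLinOp δ H ρ σ r μ w t :=
  add_le_add (mul_le_mul_of_nonneg_left (expAvg_mono hv hw hvw _) hρ)
    (mul_expAvg_sub_delay_mono hH hσ hμ hv hw hvw t)

theorem nicholsonOp_le_nicholsonLinOp (hρ : 0 ≤ ρ) {v : ℝ → ℝ} (h0 : ∀ s, 0 ≤ v s) (t : ℝ) :
    nicholsonOp δ H ρ σ r μ v t ≤ nicholsonLinOp δ H ρ σ r μ v t := by
  have h := expAvg_nonneg (μ := μ) h0 (t - r)
  refine add_le_add_left (mul_le_mul_of_nonneg_left ?_ hρ) _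
  exact mul_le_of_le_one_right h (Real.exp_le_one_iff.2 (by linarith))

/-- `e^{-u} ≥ 1 - u`: the nonlinearity costs only a quadratic error. -/
theorem nicholsonLinOp_sub_sq_le_nicholsonOp (hρ : 0 ≤ ρ) {v : ℝ → ℝ} (h0 : ∀ s, 0 ≤ v s)
    (t : ℝ) : nicholsonLinOp δ H ρ σ r μ v t - ρ * expAvg μ v (t - r) ^ 2
      ≤ nicholsonOp δ H ρ σ r μ v t := by
  have h := expAvg_nonneg (μ := μ) h0 (t - r)
  have h1 := mul_le_mul_of_nonneg_left (mul_le_mul_of_nonneg_left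
    (Real.one_sub_le_exp_neg (expAvg μ v (t - r))) h) hρ
  rw [nicholsonLinOp, nicholsonOp]
  linarith

theorem nicholsonOp_mono (hH : 0 ≤ H) (hρ : 0 ≤ ρ) (hσ : 0 ≤ σ)
    (hμ : H * Real.exp (μ * σ) ≤ μ - δ) {v w : ℝ → ℝ} (hv : ExpIntegrable μ v)
    (hw : ExpIntegrable μ w) (h0 : ∀ s, 0 ≤ v s) (hvw : ∀ s, v s ≤ w s)
    (h1 : ∀ t, expAvg μ w t ≤ 1) (t : ℝ) :
    nicholsonOp δ H ρ σ r μ v t ≤ nicholsonOp δ H ρ σ r μ w t :=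
  add_le_add (mul_le_mul_of_nonneg_left (mul_exp_neg_le_mul_exp_neg (expAvg_nonneg h0 _)
    (expAvg_mono hv hw hvw _) (h1 _)) hρ) (mul_expAvg_sub_delay_mono hH hσ hμ hv hw hvw t)

theorem nicholsonOp_comp_add_right (v : ℝ → ℝ) (h t : ℝ) :
    nicholsonOp δ H ρ σ r μ (fun s => v (s + h)) t = nicholsonOp δ H ρ σ r μ v (t + h) := by
  simp only [nicholsonOp, expAvg_comp_add_right, sub_add_eq_add_sub]

/-- An order-preserving operator that commutes with translations preserves monotonicity: compare `v`
with its forward translates. -/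
theorem monotone_nicholsonOp (hH : 0 ≤ H) (hρ : 0 ≤ ρ) (hσ : 0 ≤ σ)
    (hμ : H * Real.exp (μ * σ) ≤ μ - δ) {v : ℝ → ℝ} (hv : ExpIntegrable μ v)
    (hm : Monotone v) (h0 : ∀ s, 0 ≤ v s) (h1 : ∀ t, expAvg μ v t ≤ 1) :
    Monotone (nicholsonOp δ H ρ σ r μ v) := by
  intro a b hab
  have h := nicholsonOp_mono (r := r) hH hρ hσ hμ hv (hv.comp_add_right (b - a)) h0
    (fun s => hm (by linarith)) (fun t => by rw [expAvg_comp_add_right]; exact h1 _) a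
  rwa [nicholsonOp_comp_add_right, add_sub_cancel] at h

theorem nicholsonOp_const (hμ : 0 < μ) (c t : ℝ) :
    nicholsonOp δ H ρ σ r μ (fun _ => μ * c) t
      = ρ * (c * Real.exp (-c)) + (μ - δ - H) * c := by
  simp only [nicholsonOp, expAvg_const hμ, mul_div_cancel_left₀ c hμ.ne']
  ring

theorem hasDerivAt_expAvg_of_fixedPoint {v : ℝ → ℝ} (hv : ExpIntegrable μ v)
    (hF : ∀ t, nicholsonOp δ H ρ σ r μ v t = v t) (t : ℝ) :
    HasDerivAt (expAvg μ v) (nicholsonRHS δ H ρ σ r (expAvg μ v) t) t := by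
  have hJ := hv.continuous_expAvg
  -- A fixed point inherits continuity from its averages.
  have hc : Continuous v := by
    rw [← funext hF]
    unfold nicholsonOp
    fun_prop
  convert hv.hasDerivAt_expAvg hc t using 1
  rw [← hF t, nicholsonOp, nicholsonRHS]
  ring

theorem nicholsonOp_nonneg (hH : 0 ≤ H) (hρ : 0 ≤ ρ) (hσ : 0 ≤ σ)
    (hμ : H * Real.exp (μ * σ) ≤ μ - δ) {v : ℝ → ℝ} (hv : ExpIntegrable μ v)
    (h0 : ∀ s, 0 ≤ v s) (t : ℝ) : 0 ≤ nicholsonOp δ H ρ σ r μ v t :=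
  add_nonneg (mul_nonneg hρ (mul_nonneg (expAvg_nonneg h0 _) (Real.exp_pos _).le))
    (mul_expAvg_sub_delay_nonneg hH hσ hμ hv h0 t)

/-! ### Upper and lower solutions, existence -/

/-- `e^{λ t} - M e^{(λ + ε) t}` is a lower solution for large `M`. -/
theorem exists_lowerSolution (hH : 0 ≤ H) (hρ : 0 ≤ ρ) (hσ : 0 ≤ σ)
    (hμ : H * Real.exp (μ * σ) ≤ μ - δ) (hμ0 : 0 < μ) {lam ε b : ℝ} (hlam : 0 < lam)
    (hroot : nicholsonChar δ H ρ σ r lam = 0) (hε : 0 < ε) (hεlam : ε < lam)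
    (hχ : nicholsonChar δ H ρ σ r (lam + ε) < 0) (hb : 0 < b) :
    ∃ M : ℝ, 0 ≤ M ∧ (∀ t, Real.exp (lam * t) - M * Real.exp ((lam + ε) * t) ≤ b) ∧
      ∀ v : ℝ → ℝ, ExpIntegrable μ v → (∀ s, 0 ≤ v s) → (∀ s, v s ≤ Real.exp (lam * s)) →
        (∀ s, Real.exp (lam * s) - M * Real.exp ((lam + ε) * s) ≤ v s) →
        ∀ t, Real.exp (lam * t) - M * Real.exp ((lam + ε) * t)
          ≤ nicholsonOp δ H ρ σ r μ v t := by
  have hz : 0 < lam + μ := by linarith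
  have hzε : 0 < lam + ε + μ := by linarith
  -- `1 - c` is the eigenvalue of `e^{(λ + ε) t}`; `C e^{2 λ t}` below bounds the quadratic error.
  obtain ⟨c, hc⟩ : ∃ c, c = -(nicholsonChar δ H ρ σ r (lam + ε) / (lam + ε + μ)) := ⟨_, rfl⟩
  have hcpos : 0 < c := by rw [hc, ← neg_div]; exact div_pos (by linarith) hzε
  obtain ⟨C, hC⟩ : ∃ C, C = ρ * (Real.exp (-(lam * r)) / (lam + μ)) ^ 2 := ⟨_, rfl⟩
  have hC0 : 0 ≤ C := by rw [hC]; positivity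
  have hshift : ∀ t, Real.exp ((lam + ε) * t) = Real.exp (lam * t) * Real.exp (ε * t) := fun t => by
    rw [← Real.exp_add]; congr 1; ring
  have hfactor : ∀ M t, 1 ≤ M * Real.exp (ε * t) →
      Real.exp (lam * t) - M * Real.exp ((lam + ε) * t) ≤ 0 := fun M t h => by
    rw [hshift]
    nlinarith [mul_le_mul_of_nonneg_left h (Real.exp_pos (lam * t)).le]
  obtain ⟨K, hK⟩ : ∃ K, K = Real.exp (-(ε * (Real.log b / lam))) := ⟨_, rfl⟩
  have hK0 : 0 < K := hK ▸ Real.exp_pos _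
  have hCc : 0 ≤ C / c := div_nonneg hC0 hcpos.le
  -- The summand `1` makes the candidate nonpositive for `t ≥ 0`, `C / c` absorbs the quadratic
  -- error for `t ≤ 0`, and `K` makes the candidate nonpositive once `e^{λ t} ≥ b`.
  refine ⟨1 + C / c + K, by positivity, fun t => ?_, fun v hv h0 hvU hvL t => ?_⟩
  · rcases le_total (lam * t) (Real.log b) with h | h
    · have h1 := Real.exp_le_exp.2 h
      rw [Real.exp_log hb] at h1
      have h2 : 0 ≤ (1 + C / c + K) * Real.exp ((lam + ε) * t) := by positivity
      linarith
    · refine (hfactor _ t ?_).trans hb.le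
      have h1 : Real.log b / lam ≤ t := by rw [div_le_iff₀ hlam]; linarith
      have h2 : 1 ≤ K * Real.exp (ε * t) := by
        rw [hK, ← Real.exp_add, Real.one_le_exp_iff]
        nlinarith [mul_le_mul_of_nonneg_left h1 hε.le]
      nlinarith [mul_nonneg (add_nonneg zero_le_one hCc) (Real.exp_pos (ε * t)).le]
  · rcases le_total 0 t with ht | ht
    · refine (hfactor _ t ?_).trans (nicholsonOp_nonneg hH hρ hσ hμ hv h0 t)
      have h2 : 1 ≤ Real.exp (ε * t) := Real.one_le_exp_iff.2 (mul_nonneg hε.le ht)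
      nlinarith [mul_nonneg (add_nonneg hCc hK0.le) (Real.exp_pos (ε * t)).le]
    · have hel := expIntegrable_exp hz
      have heε := expIntegrable_exp hzε
      have h1 := nicholsonLinOp_mono (r := r) hH hρ hσ hμ (hel.sub (heε.const_mul (1 + C / c + K)))
        hv hvL t
      rw [nicholsonLinOp_sub_mul hel heε, nicholsonLinOp_exp hz, nicholsonLinOp_exp hzε, hroot,
        zero_div, ← neg_neg (_ / (lam + ε + μ)), ← hc] at h1
      have h2 := nicholsonLinOp_sub_sq_le_nicholsonOp (δ := δ) (H := H) (σ := σ) (r := r) (μ := μ)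
        hρ h0 t
      have h3 : ρ * expAvg μ v (t - r) ^ 2 ≤ C * Real.exp ((lam + ε) * t) := by
        have h4 := expAvg_mono hv hel hvU (t - r)
        rw [expAvg_exp hz] at h4
        have h5 : Real.exp (lam * (t - r)) / (lam + μ)
            = Real.exp (lam * t) * (Real.exp (-(lam * r)) / (lam + μ)) := by
          rw [← mul_div_assoc, ← Real.exp_add]; congr 2; ring
        -- Uses `ε < λ` and `t ≤ 0`.
        have h6 : Real.exp (lam * t) ^ 2 ≤ Real.exp ((lam + ε) * t) := by
          rw [← Real.exp_nat_mul, Real.exp_le_exp]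
          push_cast
          nlinarith
        calc ρ * expAvg μ v (t - r) ^ 2
            ≤ ρ * (Real.exp (lam * t) * (Real.exp (-(lam * r)) / (lam + μ))) ^ 2 := by
              rw [← h5]
              exact mul_le_mul_of_nonneg_left
                (pow_le_pow_left₀ (expAvg_nonneg h0 _) h4 2) hρ
          _ = C * Real.exp (lam * t) ^ 2 := by rw [hC]; ring
          _ ≤ _ := mul_le_mul_of_nonneg_left h6 hC0
      have h7 : C ≤ (1 + C / c + K) * c := by
        have : C / c * c = C := div_mul_cancel₀ _ hcpos.ne'
        nlinarith [mul_pos hK0 hcpos]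
      have h8 := mul_le_mul_of_nonneg_right h7 (Real.exp_pos ((lam + ε) * t)).le
      linarith

theorem exists_monotone_solution (hH : 0 ≤ H) (hρ : 0 ≤ ρ) (hσ : 0 ≤ σ)
    (hμ : H * Real.exp (μ * σ) ≤ μ - δ) (hμ0 : 0 < μ) {lam ε κ : ℝ} (hlam : 0 < lam)
    (hroot : nicholsonChar δ H ρ σ r lam = 0) (hε : 0 < ε) (hεlam : ε < lam)
    (hχ : nicholsonChar δ H ρ σ r (lam + ε) < 0) (hκ0 : 0 < κ) (hκ1 : κ ≤ 1)
    (hκ : ρ * Real.exp (-κ) = δ + H) :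
    ∃ x : ℝ → ℝ, Monotone x ∧ (∀ t, HasDerivAt x (nicholsonRHS δ H ρ σ r x t) t) ∧
      (∀ t, 0 ≤ x t) ∧ (∀ t, x t ≤ κ) ∧ (∃ t, 0 < x t) ∧ Tendsto x atBot (𝓝 0) := by
  have hz : 0 < lam + μ := by linarith
  have hel := expIntegrable_exp hz
  obtain ⟨M, hM, hMb, hML⟩ := exists_lowerSolution hH hρ hσ hμ hμ0 hlam hroot hε hεlam hχ
    (mul_pos hμ0 hκ0)
  have hexp : Monotone fun t => Real.exp (lam * t) := fun a b hab =>
    Real.exp_le_exp.2 (mul_le_mul_of_nonneg_left hab hlam.le)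
  have hint : ∀ v : ℝ → ℝ, Monotone v → (∀ t, 0 ≤ v t) →
      (∀ t, v t ≤ min (Real.exp (lam * t)) (μ * κ)) → ExpIntegrable μ v := fun v hm h0 hU =>
    expIntegrable_of_monotone hm h0 (fun t => (hU t).trans (min_le_left _ _)) hel
  have hleκ : ∀ v : ℝ → ℝ, Monotone v → (∀ t, 0 ≤ v t) →
      (∀ t, v t ≤ min (Real.exp (lam * t)) (μ * κ)) → ∀ t, expAvg μ v t ≤ κ := by
    intro v hm h0 hU t
    have h := expAvg_mono (hint v hm h0 hU) (expIntegrable_const hμ0 (μ * κ))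
      (fun s => (hU s).trans (min_le_right _ _)) t
    rwa [expAvg_const hμ0, mul_div_cancel_left₀ κ hμ0.ne'] at h
  have hUm : Monotone fun t => min (Real.exp (lam * t)) (μ * κ) := hexp.min monotone_const
  have hU0 : ∀ t, 0 ≤ min (Real.exp (lam * t)) (μ * κ) := fun t =>
    le_min (Real.exp_pos _).le (mul_pos hμ0 hκ0).le
  obtain ⟨v, hvm, hvL, hvU, hvF⟩ := exists_monotone_fixedPoint
    (F := nicholsonOp δ H ρ σ r μ)
    (L := fun t => max 0 (Real.exp (lam * t) - M * Real.exp ((lam + ε) * t)))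
    (U := fun t => min (Real.exp (lam * t)) (μ * κ)) hUm
    (fun t => max_le (hU0 t) (le_min
      (sub_le_self _ (mul_nonneg hM (Real.exp_pos _).le)) (hMb t)))
    (fun v w hv hw hL hvw hU =>
      have h0 : ∀ t, 0 ≤ v t := fun t => (le_max_left _ _).trans (hL t)
      have h0' : ∀ t, 0 ≤ w t := fun t => (h0 t).trans (hvw t)
      nicholsonOp_mono hH hρ hσ hμ (hint v hv h0 fun t => (hvw t).trans (hU t))
        (hint w hw h0' hU) h0 hvw fun t => (hleκ w hw h0' hU t).trans hκ1)
    (fun v hv hL hU =>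
      have h0 : ∀ t, 0 ≤ v t := fun t => (le_max_left _ _).trans (hL t)
      monotone_nicholsonOp hH hρ hσ hμ (hint v hv h0 hU) hv h0
        fun t => (hleκ v hv h0 hU t).trans hκ1)
    -- `e^{λ t}` is fixed by the linearization, which dominates the operator; the constant `μ κ` is
    -- fixed by the operator itself.
    (fun t => by
      have hUi := hint _ hUm hU0 fun _ => le_rfl
      refine le_min ?_ ?_
      · have h1 := nicholsonLinOp_mono (r := r) hH hρ hσ hμ hUi hel (fun s => min_le_left _ _) t
        rw [nicholsonLinOp_exp hz, hroot, zero_div, add_zero, mul_one] at h1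
        exact (nicholsonOp_le_nicholsonLinOp hρ hU0 t).trans h1
      · have h1 := nicholsonOp_mono (r := r) hH hρ hσ hμ hUi (expIntegrable_const hμ0 (μ * κ)) hU0
          (fun s => min_le_right _ _)
          (fun t => by rwa [expAvg_const hμ0, mul_div_cancel_left₀ κ hμ0.ne']) t
        rw [nicholsonOp_const hμ0] at h1
        refine h1.trans_eq ?_
        linear_combination κ * hκ)
    (fun v hv hL hU t =>
      have h0 : ∀ t, 0 ≤ v t := fun t => (le_max_left _ _).trans (hL t)
      have hvi := hint v hv h0 hU
      max_le (nicholsonOp_nonneg hH hρ hσ hμ hvi h0 t)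
        (hML v hvi h0 (fun s => (hU s).trans (min_le_left _ _))
          (fun s => (le_max_right _ _).trans (hL s)) t))
  have h0 : ∀ t, 0 ≤ v t := fun t => (le_max_left _ _).trans (hvL t)
  have hvi := hint v hvm h0 hvU
  refine ⟨expAvg μ v, monotone_expAvg hvi hvm, hasDerivAt_expAvg_of_fixedPoint hvi hvF,
    expAvg_nonneg h0, hleκ v hvm h0 hvU, ?_, ?_⟩
  · by_contra! hneg
    have hx0 : ∀ t, expAvg μ v t = 0 := fun t => le_antisymm (hneg t) (expAvg_nonneg h0 t)
    have hv0 : ∀ t, v t = 0 := fun t => by rw [← hvF t, nicholsonOp]; simp [hx0]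
    have hM1 : 0 < M + 1 := by linarith
    -- At this point `e^{ε t} = 1 / (M + 1)`, so the lower solution is positive.
    have h1 := (le_max_right _ _).trans (hvL (-Real.log (M + 1) / ε))
    have h2 : Real.exp ((lam + ε) * (-Real.log (M + 1) / ε))
        = Real.exp (lam * (-Real.log (M + 1) / ε)) * (M + 1)⁻¹ := by
      rw [← Real.exp_log (inv_pos.2 hM1), Real.log_inv, ← Real.exp_add]
      congr 1
      field_simp
      ring
    rw [hv0, h2] at h1
    have h3 : 0 < Real.exp (lam * (-Real.log (M + 1) / ε)) * (M + 1)⁻¹ := by positivity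
    have h4 : (M + 1)⁻¹ * (M + 1) = 1 := inv_mul_cancel₀ hM1.ne'
    have h5 : Real.exp (lam * (-Real.log (M + 1) / ε))
        - M * (Real.exp (lam * (-Real.log (M + 1) / ε)) * (M + 1)⁻¹)
        = Real.exp (lam * (-Real.log (M + 1) / ε)) * (M + 1)⁻¹ := by
      linear_combination -Real.exp (lam * (-Real.log (M + 1) / ε)) * h4
    linarith
  · refine squeeze_zero (g := fun t => Real.exp (lam * t) / (lam + μ)) (expAvg_nonneg h0)
      (fun t => ?_) ?_
    · rw [← expAvg_exp hz]
      exact expAvg_mono hvi hel (fun s => (hvU s).trans (min_le_left _ _)) t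
    · have h := (Real.tendsto_exp_atBot.comp
        (tendsto_id.const_mul_atBot hlam)).div_const (lam + μ)
      rwa [zero_div] at h

end Operator

/-! ### The limit at `+∞` and the conclusion -/

theorem tendsto_atTop_of_monotone_solution {δ H ρ σ r κ : ℝ} {x : ℝ → ℝ} (hρ : 0 < ρ)
    (hκ : ρ * Real.exp (-κ) = δ + H) (hm : Monotone x)
    (hx : ∀ t, HasDerivAt x (nicholsonRHS δ H ρ σ r x t) t) (hle : ∀ t, x t ≤ κ)
    (hpos : ∃ t, 0 < x t) : Tendsto x atTop (𝓝 κ) := by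
  have hbdd : BddAbove (range x) := ⟨κ, by rintro _ ⟨t, rfl⟩; exact hle t⟩
  have hc := tendsto_atTop_ciSup hm hbdd
  obtain ⟨t₀, ht₀⟩ := hpos
  have hcpos := ht₀.trans_le (le_ciSup hbdd t₀)
  obtain ⟨c, hcdef⟩ : ∃ c, c = ⨆ t, x t := ⟨_, rfl⟩
  rw [← hcdef] at hc hcpos
  have hdelay : ∀ a, Tendsto (fun t => x (t - a)) atTop (𝓝 c) := fun a =>
    hc.comp (tendsto_atTop_add_const_right _ (-a) tendsto_id)
  have hd : Tendsto (nicholsonRHS δ H ρ σ r x) atTop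
      (𝓝 (ρ * c * Real.exp (-c) - δ * c - H * c)) :=
    ((((hdelay r).const_mul ρ).mul ((Real.continuous_exp.tendsto _).comp (hdelay r).neg)).sub
      (hc.const_mul δ)).sub ((hdelay σ).const_mul H)
  have h0 := eq_zero_of_tendsto_of_tendsto_deriv hx hc hd
  -- The limit `c > 0` is an equilibrium, and `κ` is the only positive one.
  have h1 : ρ * c * (Real.exp (-c) - Real.exp (-κ)) = 0 := by linear_combination h0 - c * hκ
  have h2 := (mul_eq_zero.1 h1).resolve_left (mul_pos hρ hcpos).ne'
  have h3 : c = κ := neg_injective (Real.exp_injective (sub_eq_zero.1 h2))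
  rwa [← h3]

theorem theorem1 (δ H ρ σ r σ₀ lam : ℝ)
    (hδ : 0 ≤ δ)
    (hρ : 1 < ρ / (δ + H)) (hρe : ρ / (δ + H) ≤ Real.exp 1)
    (hlam : 0 < lam) (hroot : nicholsonChar δ H ρ σ r lam = 0)
    (hσr : σ < r)
    (hσ : 0 < σ) (hσσ₀ : σ ≤ σ₀) (hσ₀ : H * σ₀ * Real.exp (1 + σ₀ * δ) = 1)
    (hε : ∃ ε : ℝ, 0 < ε ∧ ε < lam ∧
      0 ≤ H * Real.exp (-((lam + ε) * σ)) - ρ * Real.exp (-((lam + ε) * r))) :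
    0 < Real.log (ρ / (δ + H)) ∧
      ∃ x : ℝ → ℝ,
        IsMonotoneHeteroclinic (nicholsonRHS δ H ρ σ r) 0 (Real.log (ρ / (δ + H))) x := by
  have hσ₀pos : 0 < σ₀ := hσ.trans_le hσσ₀
  have hH : 0 < H := by
    have h : 0 < H * (σ₀ * Real.exp (1 + σ₀ * δ)) := by rw [← mul_assoc, hσ₀]; exact one_pos
    exact pos_of_mul_pos_left h (by positivity)
  have hδH : 0 < δ + H := by linarith
  have hρpos : 0 < ρ := by
    have h := (one_lt_div hδH).1 hρ
    linarith
  have hlog : 0 < Real.log (ρ / (δ + H)) := Real.log_pos hρ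
  have hlog1 : Real.log (ρ / (δ + H)) ≤ 1 := (Real.log_le_iff_le_exp (by positivity)).2 hρe
  have hκ : ρ * Real.exp (-Real.log (ρ / (δ + H))) = δ + H := by
    rw [Real.exp_neg, Real.exp_log (by positivity)]
    field_simp
  -- `μ = δ + 1 / σ` maximizes `(μ - δ) e^{-μ σ}`; the condition becomes `H σ e^{1 + σ δ} ≤ 1`,
  -- which follows from `σ ≤ σ₀`.
  have hμ : H * Real.exp ((δ + 1 / σ) * σ) ≤ δ + 1 / σ - δ := by
    have h1 : (δ + 1 / σ) * σ = 1 + σ * δ := by field_simp; ring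
    rw [h1, add_sub_cancel_left, le_div_iff₀ hσ, mul_right_comm]
    refine le_trans ?_ hσ₀.le
    gcongr
  obtain ⟨ε, hε0, hεlam, hε⟩ := hε
  -- Hypothesis 3 handles the exponential terms; strictness comes from `-(λ + ε) - δ < 0`.
  have hχ : nicholsonChar δ H ρ σ r (lam + ε) < 0 := by
    rw [nicholsonChar, mul_comm σ, mul_comm r]
    linarith
  obtain ⟨x, hm, hx, -, hle, hpos, hbot⟩ := exists_monotone_solution hH.le hρpos.le hσ.le hμ
    (by positivity) hlam hroot hε0 hεlam hχ hlog hlog1 hκ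
  refine ⟨hlog, x, ⟨fun t => by simp [nicholsonRHS], fun t => ?_, ?_, hm, hx, hbot,
    tendsto_atTop_of_monotone_solution hρpos hκ hm hx hle hpos⟩⟩
  · rw [nicholsonRHS]
    linear_combination Real.log (ρ / (δ + H)) * hκ
  · have hcont : Continuous x := continuous_iff_continuousAt.2 fun t => (hx t).continuousAt
    refine contDiff_one_iff_deriv.2 ⟨fun t => (hx t).differentiableAt, ?_⟩
    rw [funext fun t => (hx t).deriv]
    unfold nicholsonRHS
    fun_prop
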